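/- **Setting.** Sequences are maps $\mathbb N\to\mathbb R$ and all asymptotic relations are for $n\to\infty$. Two sequences $f,g$ are in the same Archimedean class, $f\asymp g$, if $f=O(g)$ and $g=O(f)$; the class of $g$ is smaller than that of $f$ if $g=o(f)$. The *infinite generated sequences* are obtained from $\omega=(n)_n$ by finitely many applications of the following rules: the iterated logarithms $\ln\omega,\ln\ln\omega,\dots$; $\exp f$; $f^\alpha$ for real $\alpha>0$; $fg$ if $f\not\asymp g$; $f/g$ if $g=o(f)$; and the feedback rule: $f^{1/T}$, where $T=\sum_i d_iq_i+c$ is a finite sum, eventually positive, with nonzero real $d_i$, infinite generated $q_i$ of strictly decreasing classes and a real number $c$ (possibly $0$), and where for every $k\in\mathbb N$ eventually $T^k<\ln f$. The cardinal jumps $\exp^\omega(f)$, $\ln^\omega(f)$ are given by no formula for real sequences; they enter through an arbitrary set $J$ of further starting sequences, which may be empty: each tends to $+\infty$ and eventually equals the restriction to $\mathbb N$ of a member of one Hardy field (a field of germs at $+\infty$ of real functions, closed under differentiation). The *generated sequences* are the infinite ones, the constant $1$, and the reciprocals of the infinite ones (infinitesimals). A *set of prototypes* $P$ consists of exactly one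 generated sequence from the class of each generated sequence. A *term* is $cp$ with $p\in P$ and a real $c\ne0$. The *leading term limit* of $s$ is $cp$ if $s_n/p_n\to c$, and $0$ if $s_n=0$ eventually. The next term limits are obtained by subtracting the terms already found and repeating. A *limit* of $s$ is the finite formal sum of its first $I\ge1$ term limits (any $I$ for which they exist; "as far as one wants to take it"), or $0$ if $s_n=0$ eventually. A sequence is *smooth* if for every $N$ it has at least $N$ successive nonzero term limits, unless after finitely many subtractions the remainder is eventually $0$. *Order.* For terms, $cp<dq$ means: $q=o(p)$ and $c<0$; or $p=o(q)$ and $d>0$; or $p=q$ and $c<d$. Also $0<dq$ iff $d>0$, and $cp<0$ iff $c<0$. For two finite sums, $L<M$ means that at the first position where their terms differ, the term of $L$ is smaller than that of $M$; positions beyond the end of a sum count as $0$. **Statement.** For any two generated sequences $f,g$, one has $f\asymp g$, $f=o(g)$ or $g=o(f)$. Moreover, for every set of prototypes $P$: 1. $P$ is strictly totally ordered by $p=o(q)$. 2. A sequence has at most one leading term limit, and the set of all leading term limits is strictly totally ordered by $<$. 3. Of any two limits of one sequence, one is an initial segment of the other. The limits of smooth sequences are exactly the finite sums $\sum c_ip_i$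 of terms whose prototypes have strictly decreasing classes (including the empty sum $0$). 4. The set of all limits of smooth sequences is strictly totally ordered by the lexicographic order $<$. Moreover $\sum c_ip_i<\sum d_jq_j$ if and only if $\sum c_ip_i(n)<\sum d_jq_j(n)$ for all sufficiently large $n$. -/

import Mathlib

open Filter Topology Asymptotics

namespace AsymptoticLimit

/-- A Hardy field, given through representatives: a field of germs at `+∞` of real functions that is
closed under differentiation. -/
structure IsHardyField (H : Set (ℝ → ℝ)) : Prop where
  one_mem : (fun _ => 1) ∈ H
  sub_mem : ∀ f ∈ H, ∀ g ∈ H, (fun x => f x - g x) ∈ H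
  mul_mem : ∀ f ∈ H, ∀ g ∈ H, (fun x => f x * g x) ∈ H
  inv_mem : ∀ f ∈ H, (∀ᶠ x in atTop, f x = 0) ∨
    ((∀ᶠ x in atTop, f x ≠ 0) ∧ (fun x => (f x)⁻¹) ∈ H)
  deriv_mem : ∀ f ∈ H, (∀ᶠ x in atTop, DifferentiableAt ℝ f x) ∧ deriv f ∈ H

/-- A family of sequences that may be adjoined as values of the cardinal jumps `exp^ω` and `ln^ω`.
These operations are given by no formula on real sequences, so every family (also the empty one) of
sequences that tend to infinity and are restrictions of members of one Hardy field is allowed. -/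
def IsJumpFamily (J : Set (ℕ → ℝ)) : Prop :=
  ∃ H : Set (ℝ → ℝ), IsHardyField H ∧
    ∀ j ∈ J, Tendsto j atTop atTop ∧ ∃ F ∈ H, ∀ᶠ n : ℕ in atTop, j n = F n

/-- The real sequences generated from `ω` (the sequence `n`) and the jump sequences in `J` by
finitely many of the operations that create infinite Archimedean classes. Two sequences `f`, `g`
belong to the same Archimedean class when each is big-O of the other, `f =Θ[atTop] g`; the class of
`g` is smaller than the class of `f` when every multiple of `g` is eventually below `f`,
`g =o[atTop] f`. -/
inductive InfiniteGen (J : Set (ℕ → ℝ)) : (ℕ → ℝ) → Prop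
  /-- The identity sequence `ω`. -/
  | omega : InfiniteGen J (fun n => (n : ℝ))
  /-- The adjoined jump sequences. -/
  | jump {f : ℕ → ℝ} : f ∈ J → InfiniteGen J f
  /-- The iterated logarithms `ln ω, ln ln ω, …`. -/
  | log (k : ℕ) : InfiniteGen J (fun n => Real.log^[k + 1] (n : ℝ))
  | exp {f : ℕ → ℝ} : InfiniteGen J f → InfiniteGen J (fun n => Real.exp (f n))
  /-- Finite positive powers. -/
  | pow {f : ℕ → ℝ} (α : ℝ) : 0 < α → InfiniteGen J f → InfiniteGen J (fun n => f n ^ α)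
  /-- The product of two unequal classes. -/
  | mul {f g : ℕ → ℝ} : InfiniteGen J f → InfiniteGen J g → ¬ f =Θ[atTop] g →
      InfiniteGen J (fun n => f n * g n)
  /-- The quotient of a larger class by a smaller one. -/
  | div {f g : ℕ → ℝ} : InfiniteGen J f → InfiniteGen J g → g =o[atTop] f →
      InfiniteGen J (fun n => f n / g n)
  /-- The feedback rule `f ^ (1 / T)`. Here `T = d₀ q₀ + ⋯ + dₘ₋₁ qₘ₋₁ + c` is a positive finite
  sum without infinitesimal terms (the `qᵢ` are infinite, of strictly decreasing classes, and `c`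
  is the real term, possibly zero), and `ln f` exceeds every power of `T`. -/
  | feedback {f : ℕ → ℝ} {m : ℕ} (d : Fin m → ℝ) (q : Fin m → ℕ → ℝ) (c : ℝ) :
      InfiniteGen J f → (∀ i, d i ≠ 0) → (∀ i, InfiniteGen J (q i)) →
      (∀ i j, i < j → q j =o[atTop] q i) →
      (∀ᶠ n in atTop, 0 < (∑ i, d i * q i n) + c) →
      (∀ k : ℕ, ∀ᶠ n in atTop, ((∑ i, d i * q i n) + c) ^ k < Real.log (f n)) →
      InfiniteGen J (fun n => f n ^ (1 / ((∑ i, d i * q i n) + c)))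

/-- The generated sequences of all nonzero classes: infinite ones, the constant `1`, and the
infinitesimal ones (reciprocals of the infinite ones). -/
def Gen (J : Set (ℕ → ℝ)) (p : ℕ → ℝ) : Prop :=
  InfiniteGen J p ∨ p = (fun _ => 1) ∨ ∃ f, InfiniteGen J f ∧ p = (fun n => 1 / f n)

/-- `P` is a set of prototypes: it consists of generated sequences and contains exactly one
representative of the Archimedean class of each generated sequence (duplicates being
identified). -/
def IsPrototypeSet (J P : Set (ℕ → ℝ)) : Prop :=
  (∀ p ∈ P, Gen J p) ∧ ∀ f, Gen J f → ∃! p, p ∈ P ∧ f =Θ[atTop] p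

/-- A nonzero term `c p`: a nonzero real coefficient times a prototype. -/
structure Term (P : Set (ℕ → ℝ)) where
  coeff : ℝ
  coeff_ne : coeff ≠ 0
  proto : P

/-- The sequence `c pₙ` of a term `c p`. -/
def Term.seq {P : Set (ℕ → ℝ)} (a : Term P) : ℕ → ℝ :=
  fun n => a.coeff * a.proto.1 n

/-- The sequence `∑ cᵢ pᵢ(n)` of a finite sum of terms. -/
def sumSeq {P : Set (ℕ → ℝ)} (L : List (Term P)) : ℕ → ℝ :=
  fun n => (L.map fun a => a.seq n).sum

/-- The leading term limit of `s` is the given term `c p`, or `0` (encoded by `none`). -/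
def IsLeadingLimit {P : Set (ℕ → ℝ)} (s : ℕ → ℝ) : Option (Term P) → Prop
  | none => ∀ᶠ n in atTop, s n = 0
  | some a => Tendsto (fun n => s n / a.proto.1 n) atTop (𝓝 a.coeff)

/-- The successive terms of `L` are the first, second, … term limits of `s`: each one is the
leading term limit of what is left after subtracting the previous ones. -/
def Expands {P : Set (ℕ → ℝ)} : (ℕ → ℝ) → List (Term P) → Prop
  | _, [] => True
  | s, a :: L => IsLeadingLimit s (some a) ∧ Expands (fun n => s n - a.seq n) L

/-- `L` (read as `∑ cᵢ pᵢ`, the empty list being `0`) is the limit of `s`, taken as far as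
the length of `L`. -/
def IsLimit {P : Set (ℕ → ℝ)} (s : ℕ → ℝ) (L : List (Term P)) : Prop :=
  (L = [] ∧ ∀ᶠ n in atTop, s n = 0) ∨ (L ≠ [] ∧ Expands s L)

/-- `s` is smooth: its successive term limits exist as far as one wants to take them, that is
up to any prescribed number of terms, unless nothing is left before that. -/
def IsSmooth (P : Set (ℕ → ℝ)) (s : ℕ → ℝ) : Prop :=
  ∀ N : ℕ, ∃ L : List (Term P), Expands s L ∧
    (N ≤ L.length ∨ ∀ᶠ n in atTop, s n - sumSeq L n = 0)

/-- The set of all numbers defined by leading term limits. -/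
def leadingLimits (P : Set (ℕ → ℝ)) : Set (Option (Term P)) :=
  {a | ∃ s, IsLeadingLimit s a}

/-- The set of all limits of smooth sequences. -/
def limits (P : Set (ℕ → ℝ)) : Set (List (Term P)) :=
  {L | ∃ s, IsSmooth P s ∧ IsLimit s L}

/-- The order of leading term limits. If the classes differ, the larger class decides, through the
sign of its coefficient; if they agree, the real coefficients are compared; `0` lies between the
negative and the positive terms. -/
def LeadLT {P : Set (ℕ → ℝ)} : Option (Term P) → Option (Term P) → Prop
  | none, none => False
  | none, some b => 0 < b.coeff
  | some a, none => a.coeff < 0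
  | some a, some b =>
      (b.proto.1 =o[atTop] a.proto.1 ∧ a.coeff < 0) ∨
      (a.proto.1 =o[atTop] b.proto.1 ∧ 0 < b.coeff) ∨
      (a.proto = b.proto ∧ a.coeff < b.coeff)

/-- The lexicographic order of limits: compare by the first terms that differ (a term beyond the
end of the sum being `0`). -/
def LimLT {P : Set (ℕ → ℝ)} (L M : List (Term P)) : Prop :=
  ∃ k : ℕ, (∀ i < k, L[i]? = M[i]?) ∧ LeadLT L[k]? M[k]?

end AsymptoticLimit

/-!
All comparisons take place in one Hardy field, whose members eventually have constant sign.

* A Hardy field stays one when a primitive `y' = b`, or a positive solution of `y' = a * y`, is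
  adjoined. It suffices that polynomials in `y` over the field eventually have constant sign
  (`isHardyField_fractions`). This goes by induction on the number of coefficients: if the leading
  coefficient (for primitives) or the constant coefficient (for exponentials) is divided out, then
  differentiation removes one of them, so the derivative has constant sign by induction; the
  quotient is then eventually monotone and has constant sign too. By Zorn's lemma every Hardy field
  lies in one that is closed under both adjunctions (`IsHardyField.exists_closed`); it contains the
  constants and the identity, and is closed under `exp`, `log` and powers.
* By induction on their generation, infinite generated sequences tend to infinity and are
  restrictions of members of such a field above the one that carries the jumps
  (`InfiniteGen.tendsto`, `InfiniteGen.hasLift`). So the quotient of two generated sequences is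
  eventually on one side of every real constant, which makes their classes comparable
  (`Gen.isTheta_or_isLittleO`).
* The rest needs only that prototypes are eventually positive, and that different ones are strictly
  comparable (`IsAsymptoticScale`). After the leading term is subtracted, what is left is
  negligible against its prototype, so expansions have strictly decreasing classes
  (`Expands.pairwise`); conversely such a sum is its own expansion (`expands_sumSeq`). Both orders
  imply the eventual order of the corresponding real sequences (`eventually_lt_of_leadLT`,
  `eventually_lt_of_limLT`). As they are trichotomous, they agree with it, and transitivity is
  inherited from the order of the reals.
-/

namespace AsymptoticLimit

/-! ### Eventual derivatives and eventual signs -/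

/-- `g` is the derivative of `f` at all sufficiently large arguments. -/
def EvDeriv (f g : ℝ → ℝ) : Prop := ∀ᶠ x in atTop, HasDerivAt f (g x) x

/-- `f` is eventually zero, eventually positive or eventually negative. -/
def HasEvSign (f : ℝ → ℝ) : Prop :=
  (∀ᶠ x in atTop, f x = 0) ∨ (∀ᶠ x in atTop, 0 < f x) ∨ (∀ᶠ x in atTop, f x < 0)

theorem HasEvSign.congr {f g : ℝ → ℝ} (h : f =ᶠ[atTop] g) (hf : HasEvSign f) : HasEvSign g := by
  rcases hf with hf | hf | hf
  · exact .inl (by filter_upwards [h, hf] with x h1 h2; rw [← h1, h2])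
  · exact .inr (.inl (by filter_upwards [h, hf] with x h1 h2; rwa [← h1]))
  · exact .inr (.inr (by filter_upwards [h, hf] with x h1 h2; rwa [← h1]))

theorem HasEvSign.neg {f : ℝ → ℝ} (hf : HasEvSign f) : HasEvSign fun x => -f x := by
  rcases hf with hf | hf | hf
  · exact .inl (hf.mono fun x hx => by simp [hx])
  · exact .inr (.inr (hf.mono fun x hx => by linarith))
  · exact .inr (.inl (hf.mono fun x hx => by linarith))

theorem HasEvSign.mul {f g : ℝ → ℝ} (hf : HasEvSign f) (hg : HasEvSign g) :
    HasEvSign fun x => f x * g x := by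
  rcases hf with hf | hf | hf
  · exact .inl (hf.mono fun x hx => by simp [hx])
  · rcases hg with hg | hg | hg
    · exact .inl (hg.mono fun x hx => by simp [hx])
    · exact .inr (.inl (by filter_upwards [hf, hg] with x h1 h2 using mul_pos h1 h2))
    · exact .inr (.inr (by filter_upwards [hf, hg] with x h1 h2 using mul_neg_of_pos_of_neg h1 h2))
  · rcases hg with hg | hg | hg
    · exact .inl (hg.mono fun x hx => by simp [hx])
    · exact .inr (.inr (by filter_upwards [hf, hg] with x h1 h2 using mul_neg_of_neg_of_pos h1 h2))
    · exact .inr (.inl (by filter_upwards [hf, hg] with x h1 h2 using mul_pos_of_neg_of_neg h1 h2))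

theorem HasEvSign.zero_or_ne_zero {f : ℝ → ℝ} (hf : HasEvSign f) :
    (∀ᶠ x in atTop, f x = 0) ∨ ∀ᶠ x in atTop, f x ≠ 0 := by
  rcases hf with hf | hf | hf
  · exact .inl hf
  · exact .inr (hf.mono fun x hx => hx.ne')
  · exact .inr (hf.mono fun x hx => hx.ne)

theorem hasEvSign_of_monotoneOn {u : ℝ → ℝ} {a : ℝ} (h : MonotoneOn u (Set.Ici a)) :
    HasEvSign u := by
  by_cases h1 : ∃ x ≥ a, 0 < u x
  · obtain ⟨x, hx, hux⟩ := h1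
    refine .inr (.inl ?_)
    filter_upwards [eventually_ge_atTop x] with z hz
    exact hux.trans_le (h hx (hx.trans hz) hz)
  by_cases h2 : ∃ x ≥ a, u x = 0
  · obtain ⟨x, hx, hux⟩ := h2
    refine .inl ?_
    filter_upwards [eventually_ge_atTop x] with z hz
    have h3 := h hx (hx.trans hz) hz
    push Not at h1
    exact le_antisymm (h1 z (hx.trans hz)) (by rwa [hux] at h3)
  · push Not at h1 h2
    refine .inr (.inr ?_)
    filter_upwards [eventually_ge_atTop a] with z hz
    exact lt_of_le_of_ne (h1 z hz) (h2 z hz)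

/-- A function whose derivative eventually has constant sign is eventually monotone, hence itself
eventually has constant sign. -/
theorem EvDeriv.hasEvSign {u v : ℝ → ℝ} (h : EvDeriv u v) (hv : HasEvSign v) : HasEvSign u := by
  have key : ∀ {u v : ℝ → ℝ}, EvDeriv u v → (∀ᶠ x in atTop, 0 ≤ v x) → HasEvSign u := by
    intro u v h hv
    obtain ⟨a, ha⟩ := eventually_atTop.1 (h.and hv)
    refine hasEvSign_of_monotoneOn (a := a) (monotoneOn_of_deriv_nonneg (convex_Ici a) ?_ ?_ ?_)
    · exact fun x hx => (ha x hx).1.continuousAt.continuousWithinAt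
    · exact fun x hx =>
        (ha x (interior_subset hx)).1.differentiableAt.differentiableWithinAt
    · intro x hx
      rw [(ha x (interior_subset hx)).1.deriv]
      exact (ha x (interior_subset hx)).2
  have key' : (∀ᶠ x in atTop, v x ≤ 0) → HasEvSign u := by
    intro hv
    have h1 : EvDeriv (fun x => -u x) (fun x => -v x) := h.mono fun x hx => hx.fun_neg
    simpa using (key h1 (hv.mono fun x hx => by linarith)).neg
  rcases hv with hv | hv | hv
  · exact key h (hv.mono fun x hx => hx.ge)
  · exact key h (hv.mono fun x hx => hx.le)
  · exact key' (hv.mono fun x hx => hx.le)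

theorem eventually_eventuallyEq_nhds {f g : ℝ → ℝ} (h : f =ᶠ[atTop] g) :
    ∀ᶠ x in atTop, f =ᶠ[𝓝 x] g := by
  obtain ⟨a, ha⟩ := eventually_atTop.1 h
  filter_upwards [eventually_gt_atTop a] with x hx
  filter_upwards [Ioi_mem_nhds hx] with z hz using ha z (le_of_lt hz)

theorem EvDeriv.congr {f g f₁ g₁ : ℝ → ℝ} (h : EvDeriv f g) (hf : f₁ =ᶠ[atTop] f)
    (hg : g₁ =ᶠ[atTop] g) : EvDeriv f₁ g₁ := by
  filter_upwards [h, eventually_eventuallyEq_nhds hf, hg] with x h1 h2 h3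
  rw [h3]
  exact h1.congr_of_eventuallyEq h2

theorem EvDeriv.deriv_eventuallyEq {f g : ℝ → ℝ} (h : EvDeriv f g) : deriv f =ᶠ[atTop] g :=
  h.mono fun _ hx => hx.deriv

/-! ### Hardy fields and their extensions -/

namespace IsHardyField

variable {H : Set (ℝ → ℝ)}

theorem zero_mem (hH : IsHardyField H) : (fun _ => 0) ∈ H := by
  simpa using hH.sub_mem _ hH.one_mem _ hH.one_mem

theorem neg_mem (hH : IsHardyField H) {f : ℝ → ℝ} (hf : f ∈ H) : (fun x => -f x) ∈ H := by
  simpa using hH.sub_mem _ hH.zero_mem _ hf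

theorem add_mem (hH : IsHardyField H) {f g : ℝ → ℝ} (hf : f ∈ H) (hg : g ∈ H) :
    (fun x => f x + g x) ∈ H := by
  simpa using hH.sub_mem _ hf _ (hH.neg_mem hg)

theorem natCast_mem (hH : IsHardyField H) (n : ℕ) : (fun _ => (n : ℝ)) ∈ H := by
  induction n with
  | zero => simpa using hH.zero_mem
  | succ n ih => simpa using hH.add_mem ih hH.one_mem

theorem evDeriv (hH : IsHardyField H) {f : ℝ → ℝ} (hf : f ∈ H) : EvDeriv f (deriv f) :=
  (hH.deriv_mem f hf).1.mono fun _ hx => hx.hasDerivAt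

theorem hasEvSign (hH : IsHardyField H) {f : ℝ → ℝ} (hf : f ∈ H) : HasEvSign f := by
  rcases hH.inv_mem f hf with h | ⟨h, -⟩
  · exact .inl h
  obtain ⟨a, ha⟩ := eventually_atTop.1 (h.and (hH.deriv_mem f hf).1)
  have hcont : ContinuousOn f (Set.Ici a) := fun x hx =>
    (ha x hx).2.continuousAt.continuousWithinAt
  -- A continuous function without zeros on a half-line has constant sign there.
  rcases lt_or_gt_of_ne (ha a le_rfl).1 with h0 | h0
  · refine .inr (.inr ?_)
    filter_upwards [eventually_ge_atTop a] with x hx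
    by_contra hcon
    obtain ⟨z, hz, hz0⟩ := isPreconnected_Ici.intermediate_value (a := a) (b := x)
      Set.self_mem_Ici hx hcont ⟨h0.le, not_lt.1 hcon⟩
    exact (ha z hz).1 hz0
  · refine .inr (.inl ?_)
    filter_upwards [eventually_ge_atTop a] with x hx
    by_contra hcon
    obtain ⟨z, hz, hz0⟩ := isPreconnected_Ici.intermediate_value (a := x) (b := a)
      hx Set.self_mem_Ici hcont ⟨not_lt.1 hcon, h0.le⟩
    exact (ha z hz).1 hz0

/-- A Hardy field as a subring of the ring of all real functions. -/
def toSubring (hH : IsHardyField H) : Subring (ℝ → ℝ) where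
  carrier := H
  mul_mem' hf hg := hH.mul_mem _ hf _ hg
  one_mem' := hH.one_mem
  add_mem' hf hg := hH.add_mem hf hg
  zero_mem' := hH.zero_mem
  neg_mem' hf := hH.neg_mem hf

end IsHardyField

/-- The quotients of members of `A`: all functions that eventually equal some `p / q` with
`p, q ∈ A` and `q` eventually nonzero. -/
def fractions (A : Subring (ℝ → ℝ)) : Set (ℝ → ℝ) :=
  {h | ∃ p ∈ A, ∃ q ∈ A, (∀ᶠ x in atTop, q x ≠ 0) ∧ h =ᶠ[atTop] fun x => p x / q x}

theorem subset_fractions (A : Subring (ℝ → ℝ)) : (A : Set (ℝ → ℝ)) ⊆ fractions A :=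
  fun f hf => ⟨f, hf, 1, A.one_mem, by simp, by simp⟩

/-- The quotient field of a ring of germs is a Hardy field as soon as the members of the ring
eventually have constant sign and have their derivatives in the ring. -/
theorem isHardyField_fractions (A : Subring (ℝ → ℝ)) (hsign : ∀ f ∈ A, HasEvSign f)
    (hder : ∀ f ∈ A, ∃ g ∈ A, EvDeriv f g) : IsHardyField (fractions A) where
  one_mem := subset_fractions A A.one_mem
  sub_mem := by
    rintro f ⟨p, hp, q, hq, hq0, hf⟩ g ⟨r, hr, s, hs, hs0, hg⟩
    refine ⟨p * s - q * r, A.sub_mem (A.mul_mem hp hs) (A.mul_mem hq hr), q * s,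
      A.mul_mem hq hs, ?_, ?_⟩
    · filter_upwards [hq0, hs0] with x h1 h2 using mul_ne_zero h1 h2
    · filter_upwards [hq0, hs0, hf, hg] with x h1 h2 h3 h4
      simp only [h3, h4, Pi.sub_apply, Pi.mul_apply]
      exact div_sub_div _ _ h1 h2
  mul_mem := by
    rintro f ⟨p, hp, q, hq, hq0, hf⟩ g ⟨r, hr, s, hs, hs0, hg⟩
    refine ⟨p * r, A.mul_mem hp hr, q * s, A.mul_mem hq hs, ?_, ?_⟩
    · filter_upwards [hq0, hs0] with x h1 h2 using mul_ne_zero h1 h2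
    · filter_upwards [hf, hg] with x h3 h4
      simp only [h3, h4, Pi.mul_apply]
      exact div_mul_div_comm _ _ _ _
  inv_mem := by
    rintro f ⟨p, hp, q, hq, hq0, hf⟩
    rcases (hsign p hp).zero_or_ne_zero with h | h
    · exact .inl (by filter_upwards [hf, h] with x h1 h2; simp [h1, h2])
    · refine .inr ⟨?_, q, hq, p, hp, h, ?_⟩
      · filter_upwards [hf, h, hq0] with x h1 h2 h3
        rw [h1]
        exact div_ne_zero h2 h3
      · filter_upwards [hf] with x h1
        rw [h1, inv_div]
  deriv_mem := by
    rintro f ⟨p, hp, q, hq, hq0, hf⟩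
    obtain ⟨p', hp', hpd⟩ := hder p hp
    obtain ⟨q', hq', hqd⟩ := hder q hq
    have h1 : EvDeriv f fun x => (p' x * q x - p x * q' x) / q x ^ 2 := by
      refine EvDeriv.congr (f := fun x => p x / q x) ?_ hf (EventuallyEq.refl _ _)
      filter_upwards [hpd, hqd, hq0] with x h1 h2 h3 using h1.fun_div h2 h3
    refine ⟨h1.mono fun x hx => hx.differentiableAt, p' * q - p * q',
      A.sub_mem (A.mul_mem hp' hq) (A.mul_mem hp hq'), q ^ 2, A.pow_mem hq 2, ?_, ?_⟩
    · filter_upwards [hq0] with x hx using pow_ne_zero 2 hx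
    · exact h1.deriv_eventuallyEq

/-- Adjoining `y` to a Hardy field `H` gives a Hardy field if the polynomials in `y` over `H`
eventually have constant sign and `y' = a * y + b` with `a, b ∈ H`. -/
theorem IsHardyField.exists_adjoin {H : Set (ℝ → ℝ)} (hH : IsHardyField H) {y a b : ℝ → ℝ}
    (ha : a ∈ H) (hb : b ∈ H) (hy : EvDeriv y fun x => a x * y x + b x)
    (hsign : ∀ (n : ℕ) (c : ℕ → ℝ → ℝ), (∀ i, c i ∈ H) →
      HasEvSign fun x => ∑ i ∈ Finset.range n, c i x * y x ^ i) :
    ∃ K, IsHardyField K ∧ H ⊆ K ∧ y ∈ K := by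
  let A : Subring (ℝ → ℝ) := (Polynomial.eval₂RingHom hH.toSubring.subtype y).range
  have hHA : ∀ f ∈ H, f ∈ A := fun f hf => ⟨Polynomial.C ⟨f, hf⟩, by simp⟩
  have hyA : y ∈ A := ⟨Polynomial.X, by simp⟩
  refine ⟨fractions A, isHardyField_fractions A ?_ ?_,
    fun f hf => subset_fractions A (hHA f hf), subset_fractions A hyA⟩
  · rintro _ ⟨p, rfl⟩
    refine (hsign (p.natDegree + 1) (fun i => (p.coeff i).1) (fun i => (p.coeff i).2)).congr
      (Eventually.of_forall fun x => ?_)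
    simp [Polynomial.eval₂_eq_sum_range, Finset.sum_apply]
  · rintro _ ⟨p, rfl⟩
    induction p using Polynomial.induction_on' with
    | add p q hp hq =>
      obtain ⟨p', hp', hpd⟩ := hp
      obtain ⟨q', hq', hqd⟩ := hq
      refine ⟨p' + q', A.add_mem hp' hq', ?_⟩
      rw [map_add]
      filter_upwards [hpd, hqd] with x h1 h2 using h1.add h2
    | monomial n f =>
      have hf : (f : ℝ → ℝ) ∈ H := f.2
      refine ⟨deriv f.1 * y ^ n + f.1 * ((n : ℝ → ℝ) * y ^ (n - 1) * (a * y + b)), ?_, ?_⟩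
      · exact A.add_mem (A.mul_mem (hHA _ (hH.deriv_mem _ hf).2) (A.pow_mem hyA n))
          (A.mul_mem (hHA _ hf) (A.mul_mem (A.mul_mem (_root_.natCast_mem A n) (A.pow_mem hyA _))
            (A.add_mem (A.mul_mem (hHA _ ha) hyA) (hHA _ hb))))
      · filter_upwards [hH.evDeriv hf, hy] with x h1 h2
        simpa using h1.mul (h2.pow n)

/-- Polynomials in a primitive `y` of a member of `H`: dividing by the leading coefficient and
differentiating lowers the degree. -/
theorem IsHardyField.hasEvSign_polynomial_primitive {H : Set (ℝ → ℝ)} (hH : IsHardyField H)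
    {y b : ℝ → ℝ} (hb : b ∈ H) (hy : EvDeriv y b) (n : ℕ) :
    ∀ c : ℕ → ℝ → ℝ, (∀ i, c i ∈ H) →
      HasEvSign fun x => ∑ i ∈ Finset.range n, c i x * y x ^ i := by
  induction n with
  | zero => exact fun c hc => .inl (by simp)
  | succ n ih =>
    intro c hc
    rcases hH.inv_mem _ (hc n) with h0 | ⟨h0, hinv⟩
    · refine (ih c hc).congr ?_
      filter_upwards [h0] with x hx
      simp [Finset.sum_range_succ, hx]
    set e : ℕ → ℝ → ℝ := fun i x => c i x * (c n x)⁻¹ with he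
    have heH : ∀ i, e i ∈ H := fun i => hH.mul_mem _ (hc i) _ hinv
    -- The quotient has leading coefficient `1`, not `e n`, which is `1` only eventually; hence the
    -- case distinction in the derivative, where the coefficients `n` and `n * e n` would differ.
    have hd : EvDeriv (fun x => ∑ i ∈ Finset.range n, e i x * y x ^ i + y x ^ n)
        (fun x => ∑ i ∈ Finset.range n,
          (deriv (e i) x + (if i + 1 = n then (n : ℝ) else ((i + 1 : ℕ) : ℝ) * e (i + 1) x) * b x)
            * y x ^ i) := by
      have hev : ∀ᶠ x in atTop, ∀ i ∈ Finset.range n, HasDerivAt (e i) (deriv (e i) x) x :=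
        (Finset.eventually_all _).2 fun i _ => hH.evDeriv (heH i)
      filter_upwards [hev, hy, h0] with x h1 h2 h3
      have h4 := (HasDerivAt.fun_sum fun i hi => (h1 i hi).fun_mul (h2.fun_pow i)).add
        (h2.fun_pow n)
      refine h4.congr_deriv ?_
      simp only [add_mul, Finset.sum_add_distrib, add_assoc]
      congr 1
      cases n with
      | zero => simp
      | succ m =>
        rw [Finset.sum_range_succ', Finset.sum_range_succ]
        simp only [Nat.cast_zero, zero_mul, mul_zero, add_zero, if_true, Nat.add_sub_cancel]
        congr 1
        · refine Finset.sum_congr rfl fun i hi => ?_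
          rw [if_neg (by have := Finset.mem_range.1 hi; omega)]
          ring
        · ring
    have hu := hd.hasEvSign (ih _ fun i => hH.add_mem (hH.deriv_mem _ (heH i)).2
      (hH.mul_mem _ (by
        by_cases hi : i + 1 = n
        · simpa [hi] using hH.natCast_mem n
        · simpa [hi] using hH.mul_mem _ (hH.natCast_mem (i + 1)) _ (heH (i + 1))) _ hb))
    refine ((hH.hasEvSign (hc n)).mul hu).congr ?_
    filter_upwards [h0] with x hx
    rw [Finset.sum_range_succ, mul_add, Finset.mul_sum]
    congr 1
    refine Finset.sum_congr rfl fun i _ => ?_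
    simp only [he]
    field_simp

/-- Polynomials in a positive solution of `y' = a * y`: dividing by the constant coefficient and
differentiating leaves a multiple of `y`, so that the number of terms goes down. -/
theorem IsHardyField.hasEvSign_polynomial_exponential {H : Set (ℝ → ℝ)} (hH : IsHardyField H)
    {y a : ℝ → ℝ} (ha : a ∈ H) (hy : EvDeriv y fun x => a x * y x) (hpos : ∀ᶠ x in atTop, 0 < y x)
    (n : ℕ) : ∀ c : ℕ → ℝ → ℝ, (∀ i, c i ∈ H) →
      HasEvSign fun x => ∑ i ∈ Finset.range n, c i x * y x ^ i := by
  have hysign : HasEvSign y := .inr (.inl hpos)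
  induction n with
  | zero => exact fun c hc => .inl (by simp)
  | succ n ih =>
    intro c hc
    rcases hH.inv_mem _ (hc 0) with h0 | ⟨h0, hinv⟩
    · refine (hysign.mul (ih (fun i => c (i + 1)) fun i => hc _)).congr ?_
      filter_upwards [h0] with x hx
      rw [Finset.sum_range_succ', Finset.mul_sum, hx, zero_mul, add_zero]
      exact Finset.sum_congr rfl fun i _ => by ring
    set e : ℕ → ℝ → ℝ := fun i x => c (i + 1) x * (c 0 x)⁻¹ with he
    have heH : ∀ i, e i ∈ H := fun i => hH.mul_mem _ (hc _) _ hinv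
    have hd : EvDeriv (fun x => ∑ i ∈ Finset.range n, e i x * y x ^ (i + 1) + 1)
        (fun x => y x * ∑ i ∈ Finset.range n,
          (deriv (e i) x + ((i + 1 : ℕ) : ℝ) * (e i x * a x)) * y x ^ i) := by
      have hev : ∀ᶠ x in atTop, ∀ i ∈ Finset.range n, HasDerivAt (e i) (deriv (e i) x) x :=
        (Finset.eventually_all _).2 fun i _ => hH.evDeriv (heH i)
      filter_upwards [hev, hy] with x h1 h2
      have h4 := (HasDerivAt.fun_sum
        fun i hi => (h1 i hi).fun_mul (h2.fun_pow (i + 1))).add_const 1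
      refine h4.congr_deriv ?_
      rw [Finset.mul_sum]
      refine Finset.sum_congr rfl fun i _ => ?_
      simp only [Nat.add_sub_cancel]
      ring
    have hu := hd.hasEvSign (hysign.mul (ih _ fun i => hH.add_mem (hH.deriv_mem _ (heH i)).2
      (hH.mul_mem _ (hH.natCast_mem (i + 1)) _ (hH.mul_mem _ (heH i) _ ha))))
    refine ((hH.hasEvSign (hc 0)).mul hu).congr ?_
    filter_upwards [h0] with x hx
    rw [Finset.sum_range_succ', mul_add, Finset.mul_sum]
    congr 1
    refine Finset.sum_congr rfl fun i _ => ?_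
    simp only [he]
    field_simp

/-- The union of a nonempty chain of Hardy fields is a Hardy field. -/
theorem isHardyField_sUnion {C : Set (Set (ℝ → ℝ))} (hC : ∀ H ∈ C, IsHardyField H)
    (hchain : IsChain (· ⊆ ·) C) (hne : C.Nonempty) : IsHardyField (⋃₀ C) := by
  have h2 : ∀ f ∈ ⋃₀ C, ∀ g ∈ ⋃₀ C, ∃ H ∈ C, f ∈ H ∧ g ∈ H := by
    rintro f ⟨H, hH, hf⟩ g ⟨K, hK, hg⟩
    rcases hchain.total hH hK with h | h
    · exact ⟨K, hK, h hf, hg⟩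
    · exact ⟨H, hH, hf, h hg⟩
  refine ⟨?_, ?_, ?_, ?_, ?_⟩
  · obtain ⟨H, hH⟩ := hne
    exact ⟨H, hH, (hC H hH).one_mem⟩
  · intro f hf g hg
    obtain ⟨H, hH, hf, hg⟩ := h2 f hf g hg
    exact ⟨H, hH, (hC H hH).sub_mem f hf g hg⟩
  · intro f hf g hg
    obtain ⟨H, hH, hf, hg⟩ := h2 f hf g hg
    exact ⟨H, hH, (hC H hH).mul_mem f hf g hg⟩
  · rintro f ⟨H, hH, hf⟩
    exact ((hC H hH).inv_mem f hf).imp id fun h => ⟨h.1, H, hH, h.2⟩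
  · rintro f ⟨H, hH, hf⟩
    exact ⟨((hC H hH).deriv_mem f hf).1, H, hH, ((hC H hH).deriv_mem f hf).2⟩

/-- A Hardy field that contains all primitives of its members and all eventually positive solutions
of the equations `y' = a * y` over it. -/
structure IsClosedHardyField (M : Set (ℝ → ℝ)) : Prop extends IsHardyField M where
  primitive_mem : ∀ {y b : ℝ → ℝ}, b ∈ M → EvDeriv y b → y ∈ M
  exponential_mem : ∀ {y a : ℝ → ℝ}, a ∈ M → EvDeriv y (fun x => a x * y x) →
    (∀ᶠ x in atTop, 0 < y x) → y ∈ M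

/-- Every Hardy field is contained in a closed one, namely in any maximal Hardy field above it. -/
theorem IsHardyField.exists_closed {H : Set (ℝ → ℝ)} (hH : IsHardyField H) :
    ∃ M, IsClosedHardyField M ∧ H ⊆ M := by
  obtain ⟨M, hHM, hM⟩ := zorn_subset_nonempty {K | IsHardyField K}
    (fun C hC hchain hne => ⟨⋃₀ C, isHardyField_sUnion hC hchain hne,
      fun _ => Set.subset_sUnion_of_mem⟩) H hH
  have hMH : IsHardyField M := hM.prop
  refine ⟨M, ⟨hMH, fun {y b} hb hy => ?_, fun {y a} ha hy hpos => ?_⟩, hHM⟩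
  · obtain ⟨K, hK, hMK, hyK⟩ := hMH.exists_adjoin (y := y) hMH.zero_mem hb (by simpa using hy)
      (hMH.hasEvSign_polynomial_primitive hb hy)
    exact hM.le_of_ge hK hMK hyK
  · obtain ⟨K, hK, hMK, hyK⟩ := hMH.exists_adjoin (y := y) ha hMH.zero_mem (by simpa using hy)
      (hMH.hasEvSign_polynomial_exponential ha hy hpos)
    exact hM.le_of_ge hK hMK hyK

namespace IsClosedHardyField

variable {M : Set (ℝ → ℝ)}

theorem congr_mem (hM : IsClosedHardyField M) {f g : ℝ → ℝ} (hf : f ∈ M) (h : g =ᶠ[atTop] f) :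
    g ∈ M :=
  hM.primitive_mem (hM.deriv_mem f hf).2 ((hM.evDeriv hf).congr h (EventuallyEq.refl _ _))

theorem const_mem (hM : IsClosedHardyField M) (c : ℝ) : (fun _ => c) ∈ M :=
  hM.primitive_mem hM.zero_mem (Eventually.of_forall fun x => hasDerivAt_const x c)

theorem id_mem (hM : IsClosedHardyField M) : (fun x => x) ∈ M :=
  hM.primitive_mem hM.one_mem (Eventually.of_forall fun x => hasDerivAt_id x)

theorem inv_fun_mem (hM : IsClosedHardyField M) {f : ℝ → ℝ} (hf : f ∈ M) :
    (fun x => (f x)⁻¹) ∈ M := by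
  rcases hM.inv_mem f hf with h | h
  · exact hM.congr_mem hM.zero_mem (h.mono fun x hx => by simp [hx])
  · exact h.2

theorem div_mem (hM : IsClosedHardyField M) {f g : ℝ → ℝ} (hf : f ∈ M) (hg : g ∈ M) :
    (fun x => f x / g x) ∈ M := by
  simpa only [div_eq_mul_inv] using hM.mul_mem _ hf _ (hM.inv_fun_mem hg)

theorem sum_mem (hM : IsClosedHardyField M) {ι : Type*} (s : Finset ι) (F : ι → ℝ → ℝ)
    (hF : ∀ i, F i ∈ M) : (fun x => ∑ i ∈ s, F i x) ∈ M := by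
  have h := hM.toSubring.sum_mem (t := s) fun i _ => hF i
  have h' : (∑ i ∈ s, F i) = fun x => ∑ i ∈ s, F i x := by ext; simp
  exact h' ▸ h

theorem exp_mem (hM : IsClosedHardyField M) {f : ℝ → ℝ} (hf : f ∈ M) :
    (fun x => Real.exp (f x)) ∈ M := by
  refine hM.exponential_mem (hM.deriv_mem f hf).2 ?_ (Eventually.of_forall fun x => Real.exp_pos _)
  exact (hM.evDeriv hf).mono fun x hx => hx.exp.congr_deriv (mul_comm _ _)

theorem log_mem (hM : IsClosedHardyField M) {f : ℝ → ℝ} (hf : f ∈ M)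
    (hpos : ∀ᶠ x in atTop, 0 < f x) : (fun x => Real.log (f x)) ∈ M := by
  refine hM.primitive_mem (hM.div_mem (hM.deriv_mem f hf).2 hf) ?_
  filter_upwards [hM.evDeriv hf, hpos] with x h1 h2 using h1.log h2.ne'

theorem rpow_mem (hM : IsClosedHardyField M) {f g : ℝ → ℝ} (hf : f ∈ M)
    (hpos : ∀ᶠ x in atTop, 0 < f x) (hg : g ∈ M) : (fun x => f x ^ g x) ∈ M := by
  refine hM.congr_mem (hM.exp_mem (hM.mul_mem _ (hM.log_mem hf hpos) _ hg)) ?_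
  filter_upwards [hpos] with x hx using Real.rpow_def_of_pos hx _

end IsClosedHardyField

/-! ### Generated sequences are restrictions of members of a Hardy field -/

/-- The sequence `f` is eventually the restriction to `ℕ` of a member of `M`. -/
def HasLift (M : Set (ℝ → ℝ)) (f : ℕ → ℝ) : Prop :=
  ∃ F ∈ M, ∀ᶠ n : ℕ in atTop, f n = F n

namespace HasLift

variable {M : Set (ℝ → ℝ)} {f g : ℕ → ℝ}

theorem hasEvSign (hM : IsClosedHardyField M) (hf : HasLift M f) :
    (∀ᶠ n in atTop, f n = 0) ∨ (∀ᶠ n in atTop, 0 < f n) ∨ (∀ᶠ n in atTop, f n < 0) := by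
  obtain ⟨F, hF, h⟩ := hf
  have hcast := tendsto_natCast_atTop_atTop (R := ℝ)
  rcases hM.hasEvSign hF with h' | h' | h'
  · exact .inl (by filter_upwards [h, hcast.eventually h'] with n h1 h2; rw [h1, h2])
  · exact .inr (.inl (by filter_upwards [h, hcast.eventually h'] with n h1 h2; rwa [h1]))
  · exact .inr (.inr (by filter_upwards [h, hcast.eventually h'] with n h1 h2; rwa [h1]))

theorem const (hM : IsClosedHardyField M) (c : ℝ) : HasLift M fun _ => c :=
  ⟨_, hM.const_mem c, by simp⟩

theorem sub (hM : IsClosedHardyField M) (hf : HasLift M f) (hg : HasLift M g) :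
    HasLift M fun n => f n - g n := by
  obtain ⟨F, hF, h⟩ := hf
  obtain ⟨G, hG, h'⟩ := hg
  exact ⟨_, hM.sub_mem _ hF _ hG, by filter_upwards [h, h'] with n h1 h2; rw [h1, h2]⟩

theorem mul (hM : IsClosedHardyField M) (hf : HasLift M f) (hg : HasLift M g) :
    HasLift M fun n => f n * g n := by
  obtain ⟨F, hF, h⟩ := hf
  obtain ⟨G, hG, h'⟩ := hg
  exact ⟨_, hM.mul_mem _ hF _ hG, by filter_upwards [h, h'] with n h1 h2; rw [h1, h2]⟩

theorem add (hM : IsClosedHardyField M) (hf : HasLift M f) (hg : HasLift M g) :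
    HasLift M fun n => f n + g n := by
  obtain ⟨F, hF, h⟩ := hf
  obtain ⟨G, hG, h'⟩ := hg
  exact ⟨_, hM.add_mem hF hG, by filter_upwards [h, h'] with n h1 h2; rw [h1, h2]⟩

theorem div (hM : IsClosedHardyField M) (hf : HasLift M f) (hg : HasLift M g) :
    HasLift M fun n => f n / g n := by
  obtain ⟨F, hF, h⟩ := hf
  obtain ⟨G, hG, h'⟩ := hg
  exact ⟨_, hM.div_mem hF hG, by filter_upwards [h, h'] with n h1 h2; rw [h1, h2]⟩

theorem sum (hM : IsClosedHardyField M) {m : ℕ} {q : Fin m → ℕ → ℝ} (hq : ∀ i, HasLift M (q i)) :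
    HasLift M fun n => ∑ i, q i n := by
  choose Q hQ h using hq
  refine ⟨_, hM.sum_mem Finset.univ Q hQ, ?_⟩
  filter_upwards [eventually_all.2 h] with n hn
  exact Finset.sum_congr rfl fun i _ => hn i

theorem exp (hM : IsClosedHardyField M) (hf : HasLift M f) :
    HasLift M fun n => Real.exp (f n) := by
  obtain ⟨F, hF, h⟩ := hf
  exact ⟨_, hM.exp_mem hF, by filter_upwards [h] with n h1; rw [h1]⟩

/-- The sign of a member of `M` can be read off from its restriction to `ℕ`. -/
theorem exists_pos (hM : IsClosedHardyField M) (hf : HasLift M f) (hpos : ∀ᶠ n in atTop, 0 < f n) :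
    ∃ F ∈ M, (∀ᶠ x in atTop, 0 < F x) ∧ ∀ᶠ n : ℕ in atTop, f n = F n := by
  obtain ⟨F, hF, h⟩ := hf
  have hcast := tendsto_natCast_atTop_atTop (R := ℝ)
  rcases hM.hasEvSign hF with h' | h' | h'
  · obtain ⟨n, h1, h2, h3⟩ := (h.and (hpos.and (hcast.eventually h'))).exists
    linarith
  · exact ⟨F, hF, h', h⟩
  · obtain ⟨n, h1, h2, h3⟩ := (h.and (hpos.and (hcast.eventually h'))).exists
    linarith

theorem log (hM : IsClosedHardyField M) (hf : HasLift M f) (hpos : ∀ᶠ n in atTop, 0 < f n) :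
    HasLift M fun n => Real.log (f n) := by
  obtain ⟨F, hF, hF0, h⟩ := hf.exists_pos hM hpos
  exact ⟨_, hM.log_mem hF hF0, by filter_upwards [h] with n h1; rw [h1]⟩

theorem rpow (hM : IsClosedHardyField M) (hf : HasLift M f) (hpos : ∀ᶠ n in atTop, 0 < f n)
    (hg : HasLift M g) : HasLift M fun n => f n ^ g n := by
  obtain ⟨F, hF, hF0, h⟩ := hf.exists_pos hM hpos
  obtain ⟨G, hG, h'⟩ := hg
  exact ⟨_, hM.rpow_mem hF hF0 hG, by filter_upwards [h, h'] with n h1 h2; rw [h1, h2]⟩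

/-- Positive sequences that lift to one Hardy field have comparable Archimedean classes, because
their quotient is eventually on one side of every real constant. -/
theorem isTheta_or_isLittleO (hM : IsClosedHardyField M) (hf : HasLift M f) (hg : HasLift M g)
    (hf0 : ∀ᶠ n in atTop, 0 < f n) (hg0 : ∀ᶠ n in atTop, 0 < g n) :
    f =Θ[atTop] g ∨ f =o[atTop] g ∨ g =o[atTop] f := by
  have hcmp : ∀ c : ℝ, (∀ᶠ n in atTop, f n ≤ c * g n) ∨ (∀ᶠ n in atTop, c * g n ≤ f n) := by
    intro c
    rcases (hf.sub hM ((const hM c).mul hM hg)).hasEvSign hM with h | h | h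
    · exact .inl (h.mono fun n hn => by linarith)
    · exact .inr (h.mono fun n hn => by linarith)
    · exact .inl (h.mono fun n hn => by linarith)
  by_cases h1 : ∀ c > 0, ∀ᶠ n in atTop, f n ≤ c * g n
  · refine .inr (.inl (IsLittleO.of_bound fun c hc => ?_))
    filter_upwards [h1 c hc, hf0, hg0] with n hn h2 h3
    rwa [Real.norm_of_nonneg h2.le, Real.norm_of_nonneg h3.le]
  by_cases h2 : ∀ c > 0, ∀ᶠ n in atTop, c * g n ≤ f n
  · refine .inr (.inr (IsLittleO.of_bound fun c hc => ?_))
    filter_upwards [h2 c⁻¹ (inv_pos.2 hc), hf0, hg0] with n hn h2 h3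
    rw [Real.norm_of_nonneg h2.le, Real.norm_of_nonneg h3.le]
    rwa [inv_mul_le_iff₀ hc] at hn
  push Not at h1 h2
  obtain ⟨c, hc, h1⟩ := h1
  obtain ⟨d, hd, h2⟩ := h2
  have h1' := (hcmp c).resolve_left fun h => h1 (h.mono fun _ => not_lt.2)
  have h2' := (hcmp d).resolve_right fun h => h2 (h.mono fun _ => not_lt.2)
  refine .inl ⟨IsBigO.of_bound d ?_, IsBigO.of_bound c⁻¹ ?_⟩
  · filter_upwards [h2', hf0, hg0] with n hn h2 h3
    rwa [Real.norm_of_nonneg h2.le, Real.norm_of_nonneg h3.le]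
  · filter_upwards [h1', hf0, hg0] with n hn h2 h3
    rw [Real.norm_of_nonneg h2.le, Real.norm_of_nonneg h3.le]
    rwa [le_inv_mul_iff₀ hc]

end HasLift

theorem tendsto_iterate_log (k : ℕ) : Tendsto (Real.log^[k]) atTop atTop := by
  induction k with
  | zero => exact tendsto_id
  | succ k ih => exact ih.comp Real.tendsto_log_atTop

theorem hasLift_iterate_log {M : Set (ℝ → ℝ)} (hM : IsClosedHardyField M) (k : ℕ) :
    HasLift M fun n => Real.log^[k] n := by
  induction k with
  | zero => exact ⟨_, hM.id_mem, by simp⟩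
  | succ k ih =>
    simp only [Function.iterate_succ_apply']
    exact ih.log hM (((tendsto_iterate_log k).comp
      tendsto_natCast_atTop_atTop).eventually_gt_atTop 0)

/-- The feedback rule produces infinite sequences. -/
theorem tendsto_rpow_one_div {f T : ℕ → ℝ} (hf : Tendsto f atTop atTop)
    (hT : ∀ᶠ n in atTop, 0 < T n) (hTf : ∀ᶠ n in atTop, T n ^ 2 < Real.log (f n)) :
    Tendsto (fun n => f n ^ (1 / T n)) atTop atTop := by
  have hlog : Tendsto (fun n => Real.log (f n)) atTop atTop := Real.tendsto_log_atTop.comp hf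
  -- `T ^ 2 < ln f` gives `ln f / T ≥ √(ln f)`, which tends to infinity even if `T` is bounded.
  refine tendsto_atTop_mono' _ ?_ (Real.tendsto_exp_atTop.comp (Real.tendsto_sqrt_atTop.comp hlog))
  filter_upwards [hf.eventually_gt_atTop 0, hT, hTf] with n h1 h2 h3
  simp only [Function.comp_apply]
  rw [Real.rpow_def_of_pos h1, Real.exp_le_exp, mul_one_div, le_div_iff₀ h2]
  have h4 : T n ≤ √(Real.log (f n)) := Real.le_sqrt_of_sq_le h3.le
  calc √(Real.log (f n)) * T n ≤ √(Real.log (f n)) * √(Real.log (f n)) :=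
        mul_le_mul_of_nonneg_left h4 (Real.sqrt_nonneg _)
    _ = Real.log (f n) := Real.mul_self_sqrt ((sq_nonneg _).trans h3.le)

theorem InfiniteGen.tendsto {J : Set (ℕ → ℝ)} (hJ : ∀ j ∈ J, Tendsto j atTop atTop) {f : ℕ → ℝ}
    (hf : InfiniteGen J f) : Tendsto f atTop atTop := by
  induction hf with
  | omega => exact tendsto_natCast_atTop_atTop
  | jump h => exact hJ _ h
  | log k => exact (tendsto_iterate_log (k + 1)).comp tendsto_natCast_atTop_atTop
  | exp _ ih => exact Real.tendsto_exp_atTop.comp ih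
  | pow α hα _ ih => exact (tendsto_rpow_atTop hα).comp ih
  | mul _ _ _ ihf ihg => exact ihf.atTop_mul_atTop₀ ihg
  | div _ _ h ihf ihg =>
    have h1 := (tendsto_nhdsWithin_iff.2 ⟨h.tendsto_div_nhds_zero, by
      filter_upwards [ihf.eventually_gt_atTop 0, ihg.eventually_gt_atTop 0] with n h1 h2
      exact div_pos h2 h1⟩ : Tendsto _ atTop (𝓝[>] (0 : ℝ))).inv_tendsto_nhdsGT_zero
    exact h1.congr fun n => by simp
  | feedback d q c _ _ _ _ hpos hlt ihf _ => exact tendsto_rpow_one_div ihf hpos (hlt 2)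

theorem InfiniteGen.hasLift {J : Set (ℕ → ℝ)} {M : Set (ℝ → ℝ)} (hM : IsClosedHardyField M)
    (hJ : ∀ j ∈ J, Tendsto j atTop atTop) (hJM : ∀ j ∈ J, HasLift M j) {f : ℕ → ℝ}
    (hf : InfiniteGen J f) : HasLift M f := by
  have hev : ∀ {f}, InfiniteGen J f → ∀ᶠ n in atTop, 0 < f n := fun h =>
    (h.tendsto hJ).eventually_gt_atTop 0
  induction hf with
  | omega => exact ⟨_, hM.id_mem, by simp⟩
  | jump h => exact hJM _ h
  | log k => exact hasLift_iterate_log hM (k + 1)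
  | exp _ ih => exact ih.exp hM
  | pow α _ hf ih => exact ih.rpow hM (hev hf) (.const hM α)
  | mul _ _ _ ihf ihg => exact ihf.mul hM ihg
  | div _ _ _ ihf ihg => exact ihf.div hM ihg
  | feedback d q c hf _ _ _ _ _ ihf ihq =>
    exact ihf.rpow hM (hev hf) ((HasLift.const hM 1).div hM
      ((HasLift.sum hM fun i => (HasLift.const hM (d i)).mul hM (ihq i)).add hM (.const hM c)))

theorem Gen.eventually_pos {J : Set (ℕ → ℝ)} (hJ : IsJumpFamily J) {f : ℕ → ℝ} (hf : Gen J f) :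
    ∀ᶠ n in atTop, 0 < f n := by
  obtain ⟨H, -, hJH⟩ := hJ
  rcases hf with hf | rfl | ⟨f, hf, rfl⟩
  · exact (hf.tendsto fun j hj => (hJH j hj).1).eventually_gt_atTop 0
  · simp
  · exact ((hf.tendsto fun j hj => (hJH j hj).1).eventually_gt_atTop 0).mono
      fun n hn => one_div_pos.2 hn

theorem Gen.isTheta_or_isLittleO {J : Set (ℕ → ℝ)} (hJ : IsJumpFamily J) {f g : ℕ → ℝ}
    (hf : Gen J f) (hg : Gen J g) : f =Θ[atTop] g ∨ f =o[atTop] g ∨ g =o[atTop] f := by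
  have hf0 := hf.eventually_pos hJ
  have hg0 := hg.eventually_pos hJ
  obtain ⟨H, hH, hJH⟩ := hJ
  obtain ⟨M, hM, hHM⟩ := hH.exists_closed
  have hinf : ∀ {f}, InfiniteGen J f → HasLift M f := fun h =>
    h.hasLift hM (fun j hj => (hJH j hj).1) fun j hj =>
      let ⟨F, hF, hjF⟩ := (hJH j hj).2
      ⟨F, hHM hF, hjF⟩
  have hlift : ∀ {f}, Gen J f → HasLift M f := by
    rintro f (hf | rfl | ⟨f, hf, rfl⟩)
    · exact hinf hf
    · exact .const hM 1
    · exact (HasLift.const hM 1).div hM (hinf hf)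
  exact (hlift hf).isTheta_or_isLittleO hM (hlift hg) hf0 hg0

/-! ### Prototypes -/

/-- What is used of a set of prototypes: they are eventually positive, and different ones are of
different, comparable Archimedean classes. -/
structure IsAsymptoticScale (P : Set (ℕ → ℝ)) : Prop where
  eventually_pos : ∀ p ∈ P, ∀ᶠ n in atTop, 0 < p n
  eq_or_isLittleO : ∀ p ∈ P, ∀ q ∈ P, p = q ∨ p =o[atTop] q ∨ q =o[atTop] p

theorem IsPrototypeSet.isAsymptoticScale {J P : Set (ℕ → ℝ)} (hJ : IsJumpFamily J)
    (hP : IsPrototypeSet J P) : IsAsymptoticScale P where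
  eventually_pos p hp := (hP.1 p hp).eventually_pos hJ
  eq_or_isLittleO p hp q hq := ((hP.1 p hp).isTheta_or_isLittleO hJ (hP.1 q hq)).imp_left
    fun h => (hP.2 p (hP.1 p hp)).unique ⟨hp, isTheta_refl p atTop⟩ ⟨hq, h⟩

variable {P : Set (ℕ → ℝ)}

theorem IsAsymptoticScale.not_isLittleO_self (hP : IsAsymptoticScale P) {p : ℕ → ℝ} (hp : p ∈ P) :
    ¬ p =o[atTop] p :=
  isLittleO_irrefl ((hP.eventually_pos p hp).mono fun _ hn => hn.ne').frequently

theorem IsAsymptoticScale.isStrictTotalOrder (hP : IsAsymptoticScale P) :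
    IsStrictTotalOrder P (fun p q => p.1 =o[atTop] q.1) where
  trichotomous p q h1 h2 := by
    rcases hP.eq_or_isLittleO p.1 p.2 q.1 q.2 with h | h | h
    · exact Subtype.ext h
    · exact absurd h h1
    · exact absurd h h2
  irrefl p := hP.not_isLittleO_self p.2
  trans _ _ _ := IsLittleO.trans

/-! ### Leading term limits -/

theorem Term.ext' {a b : Term P} (h : a.proto = b.proto) (h' : a.coeff = b.coeff) : a = b := by
  cases a; cases b; simp_all

theorem isTheta_of_isLeadingLimit (hP : IsAsymptoticScale P) {s : ℕ → ℝ} {a : Term P}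
    (h : IsLeadingLimit s (some a)) : s =Θ[atTop] a.proto.1 := by
  have h0 := hP.eventually_pos _ a.proto.2
  refine ⟨isBigO_of_div_tendsto_nhds (h0.mono fun n hn h => absurd h hn.ne') _ h, ?_⟩
  have h1 : Tendsto (fun n => a.proto.1 n / s n) atTop (𝓝 a.coeff⁻¹) :=
    (Tendsto.inv₀ h a.coeff_ne).congr fun n => inv_div _ _
  refine isBigO_of_div_tendsto_nhds ?_ _ h1
  filter_upwards [Tendsto.eventually_ne h a.coeff_ne] with n hn hs
  simp [hs] at hn

theorem isLeadingLimit_unique (hP : IsAsymptoticScale P) {s : ℕ → ℝ} :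
    ∀ {a b : Option (Term P)}, IsLeadingLimit s a → IsLeadingLimit s b → a = b := by
  have key : ∀ {b : Term P}, IsLeadingLimit s (some b) → ¬ ∀ᶠ n in atTop, s n = 0 := by
    intro b hb h
    obtain ⟨n, h1, h2⟩ := ((Tendsto.eventually_ne hb b.coeff_ne).and h).exists
    simp [h2] at h1
  rintro (_ | a) (_ | b) ha hb
  · rfl
  · exact absurd ha (key hb)
  · exact absurd hb (key ha)
  · have hab := (isTheta_of_isLeadingLimit hP ha).symm.trans (isTheta_of_isLeadingLimit hP hb)
    have hp : a.proto = b.proto := by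
      rcases hP.eq_or_isLittleO _ a.proto.2 _ b.proto.2 with h | h | h
      · exact Subtype.ext h
      · exact absurd (hab.2.trans_isLittleO h) (hP.not_isLittleO_self b.proto.2)
      · exact absurd (hab.1.trans_isLittleO h) (hP.not_isLittleO_self a.proto.2)
    refine congrArg some (Term.ext' hp ?_)
    simp only [IsLeadingLimit] at ha hb
    rw [hp] at ha
    exact tendsto_nhds_unique ha hb

theorem leadLT_irrefl (hP : IsAsymptoticScale P) (a : Option (Term P)) : ¬ LeadLT a a := by
  rcases a with _ | a
  · exact id
  · rintro (⟨h, -⟩ | ⟨h, -⟩ | ⟨-, h⟩)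
    · exact hP.not_isLittleO_self a.proto.2 h
    · exact hP.not_isLittleO_self a.proto.2 h
    · exact lt_irrefl _ h

theorem leadLT_trichotomous (hP : IsAsymptoticScale P) :
    ∀ a b : Option (Term P), LeadLT a b ∨ a = b ∨ LeadLT b a := by
  rintro (_ | a) (_ | b)
  · exact .inr (.inl rfl)
  · exact (lt_or_gt_of_ne b.coeff_ne.symm).imp id .inr
  · exact (lt_or_gt_of_ne a.coeff_ne).imp id .inr
  · rcases hP.eq_or_isLittleO _ a.proto.2 _ b.proto.2 with h | h | h
    · rcases lt_trichotomy a.coeff b.coeff with h' | h' | h'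
      · exact .inl (.inr (.inr ⟨Subtype.ext h, h'⟩))
      · exact .inr (.inl (congrArg some (Term.ext' (Subtype.ext h) h')))
      · exact .inr (.inr (.inr (.inr ⟨Subtype.ext h.symm, h'⟩)))
    · rcases lt_or_gt_of_ne b.coeff_ne with h' | h'
      · exact .inr (.inr (.inl ⟨h, h'⟩))
      · exact .inl (.inr (.inl ⟨h, h'⟩))
    · rcases lt_or_gt_of_ne a.coeff_ne with h' | h'
      · exact .inl (.inl ⟨h, h'⟩)
      · exact .inr (.inr (.inr (.inl ⟨h, h'⟩)))

theorem eventually_lt_of_tendsto_div {s t p : ℕ → ℝ} {c d : ℝ} (hp : ∀ᶠ n in atTop, 0 < p n)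
    (hs : Tendsto (fun n => s n / p n) atTop (𝓝 c)) (ht : Tendsto (fun n => t n / p n) atTop (𝓝 d))
    (hcd : c < d) : ∀ᶠ n in atTop, s n < t n := by
  filter_upwards [hp, hs.eventually_lt ht hcd] with n h1 h2
  exact (div_lt_div_iff_of_pos_right h1).1 h2

/-- Any two sequences are eventually ordered as their leading term limits are. -/
theorem eventually_lt_of_leadLT (hP : IsAsymptoticScale P) {s t : ℕ → ℝ} :
    ∀ {a b : Option (Term P)}, IsLeadingLimit s a → IsLeadingLimit t b → LeadLT a b →
      ∀ᶠ n in atTop, s n < t n := by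
  have hzero : ∀ {s : ℕ → ℝ} (p : ℕ → ℝ), (∀ᶠ n in atTop, s n = 0) →
      Tendsto (fun n => s n / p n) atTop (𝓝 0) := fun p h =>
    tendsto_const_nhds.congr' (h.mono fun n hn => by simp [hn])
  rintro (_ | a) (_ | b) hs ht h
  · exact h.elim
  · exact eventually_lt_of_tendsto_div (hP.eventually_pos _ b.proto.2) (hzero _ hs) ht h
  · exact eventually_lt_of_tendsto_div (hP.eventually_pos _ a.proto.2) hs (hzero _ ht) h
  · rcases h with ⟨h, hc⟩ | ⟨h, hc⟩ | ⟨h, hc⟩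
    · exact eventually_lt_of_tendsto_div (hP.eventually_pos _ a.proto.2) hs
        ((isTheta_of_isLeadingLimit hP ht).1.trans_isLittleO h).tendsto_div_nhds_zero hc
    · exact eventually_lt_of_tendsto_div (hP.eventually_pos _ b.proto.2)
        ((isTheta_of_isLeadingLimit hP hs).1.trans_isLittleO h).tendsto_div_nhds_zero ht hc
    · simp only [IsLeadingLimit] at hs ht
      rw [h] at hs
      exact eventually_lt_of_tendsto_div (hP.eventually_pos _ b.proto.2) hs ht hc

theorem tendsto_seq_div (hP : IsAsymptoticScale P) (a : Term P) :
    Tendsto (fun n => a.seq n / a.proto.1 n) atTop (𝓝 a.coeff) :=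
  tendsto_const_nhds.congr' ((hP.eventually_pos _ a.proto.2).mono fun _ hn =>
    (mul_div_cancel_right₀ _ hn.ne').symm)

/-- The sequence `c pₙ` of a leading term limit `c p`, and `0` for the limit `0`. -/
def leadSeq : Option (Term P) → ℕ → ℝ
  | none => fun _ => 0
  | some a => a.seq

theorem isLeadingLimit_leadSeq (hP : IsAsymptoticScale P) :
    ∀ a : Option (Term P), IsLeadingLimit (leadSeq a) a
  | none => Eventually.of_forall fun _ => rfl
  | some a => tendsto_seq_div hP a

theorem leadLT_iff (hP : IsAsymptoticScale P) {a b : Option (Term P)} :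
    LeadLT a b ↔ ∀ᶠ n in atTop, leadSeq a n < leadSeq b n := by
  have key : ∀ {a b : Option (Term P)}, LeadLT a b → ∀ᶠ n in atTop, leadSeq a n < leadSeq b n :=
    fun h => eventually_lt_of_leadLT hP (isLeadingLimit_leadSeq hP _)
      (isLeadingLimit_leadSeq hP _) h
  refine ⟨key, fun h => ?_⟩
  rcases leadLT_trichotomous hP a b with h' | rfl | h'
  · exact h'
  · obtain ⟨n, hn⟩ := h.exists
    exact absurd hn (lt_irrefl _)
  · obtain ⟨n, hn, hn'⟩ := (h.and (key h')).exists
    exact absurd hn hn'.not_gt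

theorem isStrictTotalOrder_leadLT (hP : IsAsymptoticScale P) (S : Set (Option (Term P))) :
    IsStrictTotalOrder S (fun a b => LeadLT a.1 b.1) where
  trichotomous a b h1 h2 := Subtype.ext
    (((leadLT_trichotomous hP a.1 b.1).resolve_left h1).resolve_right h2)
  irrefl a := leadLT_irrefl hP a.1
  trans a b c h1 h2 := by
    rw [leadLT_iff hP] at h1 h2 ⊢
    filter_upwards [h1, h2] with n h1 h2 using h1.trans h2

/-! ### Limits -/

theorem sumSeq_cons (a : Term P) (L : List (Term P)) (n : ℕ) :
    sumSeq (a :: L) n = a.seq n + sumSeq L n := by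
  simp [sumSeq]

theorem expands_prefix (hP : IsAsymptoticScale P) :
    ∀ {s : ℕ → ℝ} {L M : List (Term P)}, Expands s L → Expands s M → L <+: M ∨ M <+: L
  | _, [], _, _, _ => .inl List.nil_prefix
  | _, _ :: _, [], _, _ => .inr List.nil_prefix
  | s, a :: L, b :: M, ⟨ha, hL⟩, ⟨hb, hM⟩ => by
    obtain rfl := Option.some_injective _ (isLeadingLimit_unique hP ha hb)
    simpa [List.cons_prefix_cons] using expands_prefix hP hL hM

theorem IsLimit.expands {s : ℕ → ℝ} {L : List (Term P)} (h : IsLimit s L) : Expands s L := by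
  rcases h with ⟨rfl, -⟩ | ⟨-, h⟩
  · trivial
  · exact h

/-- The terms of an expansion have strictly decreasing classes, because what is left after
subtracting the leading term is negligible against its prototype. -/
theorem Expands.pairwise (hP : IsAsymptoticScale P) : ∀ {s : ℕ → ℝ} {L : List (Term P)},
    Expands s L → L.Pairwise fun a b => b.proto.1 =o[atTop] a.proto.1
  | _, [], _ => .nil
  | s, a :: L, ⟨ha, hL⟩ => by
    have hrest : (fun n => s n - a.seq n) =o[atTop] a.proto.1 := by
      refine (isLittleO_iff_tendsto' ((hP.eventually_pos _ a.proto.2).mono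
        fun n hn h => absurd h hn.ne')).2 ?_
      have h := Tendsto.sub ha (tendsto_seq_div hP a)
      simpa only [sub_self, ← sub_div] using h
    have hpw := Expands.pairwise hP hL
    refine List.pairwise_cons.2 ⟨?_, hpw⟩
    rcases L with _ | ⟨b, L⟩
    · simp
    · have hb := (isTheta_of_isLeadingLimit hP hL.1).2.trans_isLittleO hrest
      rintro c (_ | ⟨_, hc⟩)
      · exact hb
      · exact ((List.pairwise_cons.1 hpw).1 c hc).trans hb

theorem sumSeq_isLittleO {p : ℕ → ℝ} :
    ∀ {L : List (Term P)}, (∀ b ∈ L, b.proto.1 =o[atTop] p) → sumSeq L =o[atTop] p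
  | [], _ => (isLittleO_zero p atTop).congr_left fun n => by simp [sumSeq]
  | b :: L, h => by
    have h1 : b.seq =o[atTop] p := (h b (by simp)).const_mul_left b.coeff
    exact (h1.add (sumSeq_isLittleO fun c hc => h c (by simp [hc]))).congr_left
      fun n => (sumSeq_cons b L n).symm

theorem isLeadingLimit_sumSeq (hP : IsAsymptoticScale P) {L : List (Term P)}
    (hL : L.Pairwise fun a b => b.proto.1 =o[atTop] a.proto.1) :
    IsLeadingLimit (sumSeq L) L.head? := by
  rcases L with _ | ⟨a, L⟩
  · exact Eventually.of_forall fun n => by simp [sumSeq]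
  · have h := (tendsto_seq_div hP a).add
      (sumSeq_isLittleO (List.pairwise_cons.1 hL).1).tendsto_div_nhds_zero
    simp only [add_zero, ← add_div, ← sumSeq_cons] at h
    exact h

theorem expands_sumSeq (hP : IsAsymptoticScale P) :
    ∀ {L : List (Term P)}, (L.Pairwise fun a b => b.proto.1 =o[atTop] a.proto.1) →
      Expands (sumSeq L) L
  | [], _ => trivial
  | a :: L, h => ⟨isLeadingLimit_sumSeq hP h, by
      simpa only [sumSeq_cons, add_sub_cancel_left] using
        expands_sumSeq hP (List.pairwise_cons.1 h).2⟩

theorem limits_eq (hP : IsAsymptoticScale P) :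
    limits P = {L | L.Pairwise fun a b => b.proto.1 =o[atTop] a.proto.1} := by
  ext L
  refine ⟨fun ⟨s, _, hs⟩ => hs.expands.pairwise hP, fun h => ⟨sumSeq L, fun N => ?_, ?_⟩⟩
  · exact ⟨L, expands_sumSeq hP h, .inr (by simp)⟩
  · by_cases hL : L = []
    · exact .inl ⟨hL, by simp [hL, sumSeq]⟩
    · exact .inr ⟨hL, expands_sumSeq hP h⟩

/-! ### The lexicographic order -/

theorem limLT_trichotomous (hP : IsAsymptoticScale P) (L M : List (Term P)) :
    LimLT L M ∨ L = M ∨ LimLT M L := by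
  classical
  by_cases h : ∃ k : ℕ, L[k]? ≠ M[k]?
  · have hmin : ∀ i < Nat.find h, L[i]? = M[i]? := fun i hi => not_not.1 (Nat.find_min h hi)
    rcases leadLT_trichotomous hP L[Nat.find h]? M[Nat.find h]? with h' | h' | h'
    · exact .inl ⟨_, hmin, h'⟩
    · exact absurd h' (Nat.find_spec h)
    · exact .inr (.inr ⟨_, fun i hi => (hmin i hi).symm, h'⟩)
  · push Not at h
    exact .inr (.inl (List.ext_getElem? h))

theorem eventually_lt_of_limLT (hP : IsAsymptoticScale P) {L M : List (Term P)}
    (hL : L.Pairwise fun a b => b.proto.1 =o[atTop] a.proto.1)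
    (hM : M.Pairwise fun a b => b.proto.1 =o[atTop] a.proto.1) (h : LimLT L M) :
    ∀ᶠ n in atTop, sumSeq L n < sumSeq M n := by
  obtain ⟨k, heq, hlt⟩ := h
  induction k generalizing L M with
  | zero =>
    rw [← List.head?_eq_getElem?, ← List.head?_eq_getElem?] at hlt
    exact eventually_lt_of_leadLT hP (isLeadingLimit_sumSeq hP hL) (isLeadingLimit_sumSeq hP hM) hlt
  | succ k ih =>
    have h0 := heq 0 k.succ_pos
    rcases L with _ | ⟨a, L⟩ <;> rcases M with _ | ⟨b, M⟩
    · exact hlt.elim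
    · simp at h0
    · simp at h0
    · obtain rfl : a = b := by simpa using h0
      have hrec := ih (List.pairwise_cons.1 hL).2 (List.pairwise_cons.1 hM).2
        (fun i hi => by simpa using heq (i + 1) (by omega)) (by simpa using hlt)
      filter_upwards [hrec] with n hn
      simpa only [sumSeq_cons, add_lt_add_iff_left] using hn

theorem limLT_iff (hP : IsAsymptoticScale P) {L M : List (Term P)}
    (hL : L.Pairwise fun a b => b.proto.1 =o[atTop] a.proto.1)
    (hM : M.Pairwise fun a b => b.proto.1 =o[atTop] a.proto.1) :
    LimLT L M ↔ ∀ᶠ n in atTop, sumSeq L n < sumSeq M n := by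
  refine ⟨eventually_lt_of_limLT hP hL hM, fun h => ?_⟩
  rcases limLT_trichotomous hP L M with h' | rfl | h'
  · exact h'
  · obtain ⟨n, hn⟩ := h.exists
    exact absurd hn (lt_irrefl _)
  · obtain ⟨n, hn, hn'⟩ := (h.and (eventually_lt_of_limLT hP hM hL h')).exists
    exact absurd hn hn'.not_gt

theorem isStrictTotalOrder_limLT (hP : IsAsymptoticScale P) :
    IsStrictTotalOrder (limits P) (fun L M => LimLT L.1 M.1) := by
  have hpw : ∀ L : limits P, L.1.Pairwise fun a b => b.proto.1 =o[atTop] a.proto.1 := fun L =>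
    (limits_eq hP).subset L.2
  exact
    { trichotomous := fun L M h1 h2 => Subtype.ext
        (((limLT_trichotomous hP L.1 M.1).resolve_left h1).resolve_right h2)
      irrefl := fun L ⟨_, _, h⟩ => leadLT_irrefl hP _ h
      trans := fun L M N h1 h2 => by
        rw [limLT_iff hP (hpw _) (hpw _)] at h1 h2 ⊢
        filter_upwards [h1, h2] with n h1 h2 using h1.trans h2 }

end AsymptoticLimit

theorem mainTheorem2 (J : Set (ℕ → ℝ)) (hJ : AsymptoticLimit.IsJumpFamily J) :
    -- Two generated sequences are in the same class or strictly comparable.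
    (∀ f g : ℕ → ℝ, AsymptoticLimit.Gen J f → AsymptoticLimit.Gen J g →
      f =Θ[atTop] g ∨ f =o[atTop] g ∨ g =o[atTop] f) ∧
    ∀ P : Set (ℕ → ℝ), AsymptoticLimit.IsPrototypeSet J P →
      -- The prototypes are strictly ordered by their Archimedean classes.
      IsStrictTotalOrder P (fun p q => p.1 =o[atTop] q.1) ∧
      -- Leading term limits are unique, and ordered.
      (∀ (s : ℕ → ℝ) (a b : Option (AsymptoticLimit.Term P)),
        AsymptoticLimit.IsLeadingLimit s a → AsymptoticLimit.IsLeadingLimit s b → a = b) ∧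
      IsStrictTotalOrder (AsymptoticLimit.leadingLimits P)
        (fun a b => AsymptoticLimit.LeadLT a.1 b.1) ∧
      -- Limits are unique, up to how far they are taken.
      (∀ (s : ℕ → ℝ) (L M : List (AsymptoticLimit.Term P)),
        AsymptoticLimit.IsLimit s L → AsymptoticLimit.IsLimit s M → L <+: M ∨ M <+: L) ∧
      -- The limits are the finite sums of terms of strictly decreasing classes.
      AsymptoticLimit.limits P =
        {L | L.Pairwise fun a b => b.proto.1 =o[atTop] a.proto.1} ∧
      -- The set of all limits is ordered lexicographically.
      IsStrictTotalOrder (AsymptoticLimit.limits P)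
        (fun L M => AsymptoticLimit.LimLT L.1 M.1) ∧
      -- This is the eventual order of the sums as real sequences.
      (∀ L ∈ AsymptoticLimit.limits P, ∀ M ∈ AsymptoticLimit.limits P,
        AsymptoticLimit.LimLT L M ↔
          ∀ᶠ n in atTop, AsymptoticLimit.sumSeq L n < AsymptoticLimit.sumSeq M n) := by
  refine ⟨fun f g hf hg => hf.isTheta_or_isLittleO hJ hg, fun P hPJ => ?_⟩
  have hP := hPJ.isAsymptoticScale hJ
  have hlim := AsymptoticLimit.limits_eq hP
  exact ⟨hP.isStrictTotalOrder,
    fun s a b => AsymptoticLimit.isLeadingLimit_unique hP,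
    AsymptoticLimit.isStrictTotalOrder_leadLT hP _,
    fun s L M hL hM => AsymptoticLimit.expands_prefix hP hL.expands hM.expands,
    hlim, AsymptoticLimit.isStrictTotalOrder_limLT hP,
    fun L hL M hM => AsymptoticLimit.limLT_iff hP (hlim.subset hL) (hlim.subset hM)⟩
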